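/- Let $X$ be a reflexive Banach space (real or complex), let $K$ be a nonempty, convex, bounded, closed subset of $X$, and let $F$ be a map defined on $K$ such that $F(K)\subset K$. Assume that there is a Banach space $Y$ (over the same field) such that: (i) $X\subset Y$ with compact immersion, i.e. $X$ is embedded in $Y$ by an injective compact linear map; (ii) whenever a sequence $v_n\in K$ converges weakly in $X$ to some $v\in K$, there is a subsequence $(v_m)$ of $(v_n)$ such that $F(v_m)\to F(v)$ in the norm of $Y$. Then $F$ has a fixed point in $K$, i.e. there is $x\in K$ with $F(x)=x$. -/

import Mathlib

open Filter Topology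

/-- A normed space `E` over `𝕜` is reflexive if the canonical embedding `x ↦ (f ↦ f x)` of `E` into
its topological bidual is surjective. -/
def IsReflexiveSpace (𝕜 : Type*) [RCLike 𝕜] (E : Type*) [NormedAddCommGroup E]
    [NormedSpace 𝕜 E] : Prop :=
  Function.Surjective (NormedSpace.inclusionInDoubleDual 𝕜 E)

/-- The sequence `u` converges to `x` in the weak topology of `E`. -/
def WeaklyConverges (𝕜 : Type*) [RCLike 𝕜] {E : Type*} [NormedAddCommGroup E]
    [NormedSpace 𝕜 E] (u : ℕ → E) (x : E) : Prop :=
  Tendsto (fun n => toWeakSpace 𝕜 E (u n)) atTop (𝓝 (toWeakSpace 𝕜 E x))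

/-!
The set `K` is weakly compact, so the injective map `ι` is a homeomorphism from `K` with the weak
topology onto `ι '' K`, which is compact in norm because `ι` is a compact operator. The hypothesis
on `F` says exactly that `F`, transported along `ι`, is continuous on the compact convex set
`ι '' K`, and Schauder's theorem gives a fixed point.

Schauder's theorem reduces to Brouwer's on a simplex through a partition of unity, and Brouwer's to
the nonexistence of a `C¹` retraction of a ball `U` onto its sphere, proved by the volume argument
of Milnor and Rogers: if `h` is Lipschitz and vanishes outside `U`, then for small `t` the map
`x ↦ x + t • h x` is a bijection of `U`, so that `∫ x in U, det (1 + t • Dh x)` is the volume of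
`U`; being polynomial in `t`, the integral equals this volume at `t = 1` as well. For a retraction
`x ↦ x + h x` onto the sphere, however, the determinant at `t = 1` vanishes.
-/

open MeasureTheory Metric

section DetPolynomial

open Polynomial

theorem eval_eq_sum_eval_lagrangeBasis {F ι : Type*} [Field F] [DecidableEq ι] {s : Finset ι}
    {v : ι → F} (hv : Set.InjOn v s) {p : F[X]} (hp : p.degree < s.card) (x : F) :
    p.eval x = ∑ i ∈ s, (Lagrange.basis s v i).eval x * p.eval (v i) := by
  conv_lhs => rw [Lagrange.eq_interpolate hv hp, Lagrange.interpolate_apply]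
  simp only [eval_finsetSum, eval_mul, eval_C, mul_comm]

theorem integral_eval_eq_of_infinite {α : Type*} [MeasurableSpace α] {μ : Measure α}
    {p : α → ℝ[X]} {n : ℕ} (hp : ∀ x, (p x).natDegree ≤ n) {S : Set ℝ} (hS : S.Infinite) {c : ℝ}
    (hint : ∀ t ∈ S, Integrable (fun x => (p x).eval t) μ)
    (hc : ∀ t ∈ S, ∫ x, (p x).eval t ∂μ = c) (t : ℝ) : ∫ x, (p x).eval t ∂μ = c := by
  obtain ⟨s, hsS, hs⟩ := hS.exists_subset_card_eq (n + 1)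
  have interpolate : ∀ q : ℝ[X], q.natDegree ≤ n →
      q.eval t = ∑ i ∈ s, (Lagrange.basis s id i).eval t * q.eval i := fun q hq =>
    eval_eq_sum_eval_lagrangeBasis (Set.injOn_id _)
      (degree_le_natDegree.trans_lt (by rw [hs]; exact_mod_cast Nat.lt_succ_of_le hq)) t
  have weights_sum : ∑ i ∈ s, (Lagrange.basis s id i).eval t = 1 := by
    simpa using (interpolate 1 (by simp)).symm
  calc ∫ x, (p x).eval t ∂μ
      = ∫ x, ∑ i ∈ s, (Lagrange.basis s id i).eval t * (p x).eval i ∂μ := by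
        simp only [interpolate _ (hp _)]
    _ = ∑ i ∈ s, (Lagrange.basis s id i).eval t * c := by
        rw [integral_finsetSum _ fun i hi => (hint i (hsS hi)).const_mul _]
        exact Finset.sum_congr rfl fun i hi => by rw [integral_const_mul, hc i (hsS hi)]
    _ = c := by rw [← Finset.sum_mul, weights_sum, one_mul]

theorem exists_polynomial_eval_eq_det_one_add_smul {R M : Type*} [CommRing R] [Nontrivial R]
    [AddCommGroup M] [Module R M] [Module.Free R M] [Module.Finite R M] (f : Module.End R M) :
    ∃ p : R[X], p.natDegree ≤ Module.finrank R M ∧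
      ∀ t, p.eval t = LinearMap.det (1 + t • f) := by
  let b := Module.Free.chooseBasis R M
  let A := LinearMap.toMatrix b b f
  refine ⟨((X : R[X]) • A.map C + (1 : Matrix _ _ R).map C).det, ?_, fun t => ?_⟩
  · exact (natDegree_det_X_add_C_le A (1 : Matrix _ _ R)).trans_eq
      (Module.finrank_eq_card_chooseBasisIndex R M).symm
  · rw [← LinearMap.det_toMatrix b, map_add, map_smul, LinearMap.toMatrix_one, ← coe_evalRingHom,
      RingHom.map_det]
    congr 1
    ext i j
    by_cases hij : i = j <;> simp [A, hij, add_comm, mul_comm t]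

end DetPolynomial

section ChangeOfVariables

variable {E : Type*} [NormedAddCommGroup E] [NormedSpace ℝ E]

theorem eventually_forall_det_one_add_smul_pos {α : Type*} {A : α → E →L[ℝ] E} {C : ℝ}
    (hA : ∀ a, ‖A a‖ ≤ C) : ∀ᶠ t : ℝ in 𝓝 0, ∀ a, 0 < (1 + t • A a).det := by
  have det_pos : ∀ᶠ B in 𝓝 (0 : E →L[ℝ] E), 0 < (1 + B).det := by
    have : Continuous fun B : E →L[ℝ] E => (1 + B).det :=
      ContinuousLinearMap.continuous_det.comp (continuous_const_add 1)
    refine this.continuousAt.eventually (lt_mem_nhds ?_)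
    simp [ContinuousLinearMap.det]
  obtain ⟨δ, hδ, det_pos_of_norm_lt⟩ := Metric.eventually_nhds_iff.1 det_pos
  have small : ∀ᶠ t : ℝ in 𝓝 0, |t| * C < δ := by
    refine (by fun_prop : Continuous fun t : ℝ => |t| * C).continuousAt.eventually
      (gt_mem_nhds (by simpa using hδ))
  filter_upwards [small] with t ht a
  refine det_pos_of_norm_lt ?_
  rw [dist_zero_right, norm_smul, Real.norm_eq_abs]
  exact (mul_le_mul_of_nonneg_left (hA a) (abs_nonneg t)).trans_lt ht

variable [FiniteDimensional ℝ E] [MeasurableSpace E] [BorelSpace E]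
  (μ : Measure E) [μ.IsAddHaarMeasure] {s : Set E} {f : E → E} {f' : E → E →L[ℝ] E}

theorem integrableOn_det_fderiv_iff (hs : MeasurableSet s)
    (hf' : ∀ x ∈ s, HasFDerivWithinAt f (f' x) s x) (hf : Set.InjOn f s)
    (hdet : ∀ x ∈ s, 0 ≤ (f' x).det) :
    IntegrableOn (fun x => (f' x).det) s μ ↔ μ (f '' s) < ⊤ := by
  have abs_det : Set.EqOn (fun x => |(f' x).det| • (1 : ℝ)) (fun x => (f' x).det) s :=
    fun x hx => by simp only [smul_eq_mul, mul_one, abs_of_nonneg (hdet x hx)]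
  rw [← integrableOn_congr_fun abs_det hs,
    ← integrableOn_image_iff_integrableOn_abs_det_fderiv_smul μ hs hf' hf (fun _ => (1 : ℝ)),
    integrableOn_const_iff]
  simp

theorem setIntegral_det_fderiv_eq_measureReal_image (hs : MeasurableSet s)
    (hf' : ∀ x ∈ s, HasFDerivWithinAt f (f' x) s x) (hf : Set.InjOn f s)
    (hdet : ∀ x ∈ s, 0 ≤ (f' x).det) :
    ∫ x in s, (f' x).det ∂μ = μ.real (f '' s) := by
  have change_of_variables :=
    integral_image_eq_integral_abs_det_fderiv_smul μ hs hf' hf fun _ => (1 : ℝ)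
  rw [setIntegral_const, smul_eq_mul, mul_one] at change_of_variables
  rw [change_of_variables]
  exact setIntegral_congr_fun hs fun x hx => by
    simp only [smul_eq_mul, mul_one, abs_of_nonneg (hdet x hx)]

end ChangeOfVariables

section IdentityPerturbation

theorem bijective_id_add_of_lipschitzWith {E : Type*} [NormedAddCommGroup E] [NormedSpace ℝ E]
    [CompleteSpace E] {c : NNReal} {g : E → E} (hg : LipschitzWith c g) (hc : c < 1) :
    Function.Bijective fun x => x + g x := by
  have approx : ApproximatesLinearOn (fun x => x + g x)
      (ContinuousLinearEquiv.refl ℝ E : E →L[ℝ] E) Set.univ c := by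
    rw [ApproximatesLinearOn.approximatesLinearOn_iff_lipschitzOnWith]
    convert hg.lipschitzOnWith using 1
    ext x
    simp
  have hc' : Subsingleton E ∨
      c < ‖((ContinuousLinearEquiv.refl ℝ E).symm : E →L[ℝ] E)‖₊⁻¹ := by
    rcases subsingleton_or_nontrivial E with hE | hE
    · exact .inl hE
    · exact .inr (by simpa using hc)
  exact ⟨Set.injOn_univ.1 (approx.injOn hc'), approx.surjective hc'⟩

theorem image_eq_of_bijective_of_eqOn_compl {α : Type*} {g : α → α} {U : Set α}
    (hg : Function.Bijective g) (hgU : Set.EqOn g id Uᶜ) : g '' U = U := by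
  have image_compl := hgU.image_eq
  rw [Set.image_id, Set.image_compl_eq hg] at image_compl
  exact compl_injective image_compl

variable {E : Type*} [NormedAddCommGroup E] [NormedSpace ℝ E] [FiniteDimensional ℝ E]
  [MeasurableSpace E] [BorelSpace E] (μ : Measure E) [μ.IsAddHaarMeasure]
  {U : Set E} {L : NNReal} {h : E → E}

theorem setIntegral_det_one_add_smul_fderiv (hU : MeasurableSet U) (hμU : μ U < ⊤)
    (hL : LipschitzWith L h) (hd : ∀ x ∈ U, DifferentiableAt ℝ h x) (h0 : ∀ x ∉ U, h x = 0)
    (t : ℝ) : ∫ x in U, (1 + t • fderiv ℝ h x).det ∂μ = μ.real U := by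
  choose p hp_deg hp using fun x =>
    exists_polynomial_eval_eq_det_one_add_smul (fderiv ℝ h x : Module.End ℝ E)
  have eval_p : ∀ t x, (1 + t • fderiv ℝ h x).det = (p x).eval t := fun t x => (hp x t).symm
  have small : ∀ᶠ t : ℝ in 𝓝 0, ‖t‖₊ * L < 1 :=
    (by fun_prop : Continuous fun t : ℝ => ‖t‖₊ * L).continuousAt.eventually
      (gt_mem_nhds (by simp))
  have det_pos := eventually_forall_det_one_add_smul_pos fun x =>
    norm_fderiv_le_of_lipschitz ℝ (x₀ := x) hL
  have hderiv : ∀ t : ℝ, ∀ x ∈ U,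
      HasFDerivWithinAt (fun x => x + t • h x) (1 + t • fderiv ℝ h x) U x := fun t x hx =>
    ((hasFDerivAt_id x).add ((hd x hx).hasFDerivAt.const_smul t)).hasFDerivWithinAt
  have hbij : ∀ t : ℝ, ‖t‖₊ * L < 1 → Function.Bijective fun x => x + t • h x := fun t ht =>
    bijective_id_add_of_lipschitzWith ((lipschitzWith_smul t).comp hL) ht
  have himage : ∀ t : ℝ, ‖t‖₊ * L < 1 → (fun x => x + t • h x) '' U = U := fun t ht =>
    image_eq_of_bijective_of_eqOn_compl (hbij t ht) fun x hx => by simp [h0 x hx]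
  simp only [eval_p]
  refine integral_eval_eq_of_infinite hp_deg (infinite_of_mem_nhds 0 (small.and det_pos))
    (fun t ⟨ht, hpos⟩ => ?_) (fun t ⟨ht, hpos⟩ => ?_) t <;> simp only [← eval_p]
  · refine (integrableOn_det_fderiv_iff μ hU (hderiv t) (hbij t ht).injective.injOn
      fun x _ => (hpos x).le).2 ?_
    rwa [himage t ht]
  · rw [setIntegral_det_fderiv_eq_measureReal_image μ hU (hderiv t) (hbij t ht).injective.injOn
      fun x _ => (hpos x).le, himage t ht]

end IdentityPerturbation

section Brouwer

theorem inter_frontier_nonempty_of_isPreconnected {X : Type*} [TopologicalSpace X] {s t : Set X}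
    (ht : IsPreconnected t) (hts : (t ∩ s).Nonempty) (hts' : (t \ s).Nonempty) :
    (t ∩ frontier s).Nonempty := by
  by_contra! hdisj
  have mem_interior : ∀ z ∈ t, z ∈ closure s → z ∈ interior s := fun z hzt hz =>
    by_contra fun hzs => Set.notMem_empty z (hdisj ▸ ⟨hzt, hz, hzs⟩)
  obtain ⟨x, hxt, hx⟩ := hts
  obtain ⟨y, hyt, hy⟩ := hts'
  refine hy (interior_subset (ht.subset_of_closure_inter_subset isOpen_interior
    ⟨x, hxt, mem_interior x hxt (subset_closure hx)⟩ ?_ hyt))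
  exact fun z ⟨hz, hzt⟩ => mem_interior z hzt (closure_mono interior_subset hz)

theorem lipschitzWith_indicator_of_lipschitzOnWith_closure {E F : Type*} [NormedAddCommGroup E]
    [NormedSpace ℝ E] [NormedAddCommGroup F] {s : Set E} {L : NNReal} {k : E → F}
    (hk : LipschitzOnWith L k (closure s)) (h0 : ∀ x ∈ frontier s, k x = 0) :
    LipschitzWith L (s.indicator k) := by
  have dist_le_of_crossing : ∀ x ∈ s, ∀ y ∉ s, dist (k x) 0 ≤ L * dist x y := by
    intro x hx y hy
    obtain ⟨z, hz, hzs⟩ := inter_frontier_nonempty_of_isPreconnected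
      (convex_segment (𝕜 := ℝ) x y).isPreconnected ⟨x, left_mem_segment ℝ x y, hx⟩
      ⟨y, right_mem_segment ℝ x y, hy⟩
    calc dist (k x) 0 = dist (k x) (k z) := by rw [h0 z hzs]
      _ ≤ L * dist x z := hk.dist_le_mul x (subset_closure hx) z (frontier_subset_closure hzs)
      _ ≤ L * dist x y := by
        gcongr
        exact (le_add_of_nonneg_right dist_nonneg).trans_eq (dist_add_dist_of_mem_segment hz)
  refine LipschitzWith.of_dist_le_mul fun x y => ?_
  by_cases hx : x ∈ s <;> by_cases hy : y ∈ s
  · rw [Set.indicator_of_mem hx, Set.indicator_of_mem hy]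
    exact hk.dist_le_mul _ (subset_closure hx) _ (subset_closure hy)
  · rw [Set.indicator_of_mem hx, Set.indicator_of_notMem hy]
    exact dist_le_of_crossing x hx y hy
  · rw [Set.indicator_of_notMem hx, Set.indicator_of_mem hy, dist_comm, dist_comm x]
    exact dist_le_of_crossing y hy x hx
  · rw [Set.indicator_of_notMem hx, Set.indicator_of_notMem hy, dist_self]
    positivity

theorem exists_lipschitzWith_indicator_ball_of_contDiff {E F : Type*}
    [NormedAddCommGroup E] [NormedSpace ℝ E] [FiniteDimensional ℝ E] [NormedAddCommGroup F]
    [NormedSpace ℝ F] {k : E → F} {c : E} {R : ℝ} (hk : ContDiff ℝ 1 k)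
    (h0 : ∀ x ∈ sphere c R, k x = 0) : ∃ L, LipschitzWith L ((ball c R).indicator k) := by
  obtain ⟨L, hL⟩ := hk.contDiffOn.exists_lipschitzOnWith one_ne_zero
    (convex_closedBall c R) (isCompact_closedBall c R)
  exact ⟨L, lipschitzWith_indicator_of_lipschitzOnWith_closure
    (hL.mono closure_ball_subset_closedBall) fun x hx => h0 x (frontier_ball_subset_sphere hx)⟩

variable {E : Type*} [NormedAddCommGroup E] [InnerProductSpace ℝ E]

theorem exists_lipschitzWith_one_retraction {K : Set E} (hne : K.Nonempty)
    (hcomplete : IsComplete K) (hconv : Convex ℝ K) :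
    ∃ p : E → K, LipschitzWith 1 p ∧ ∀ x : K, p x = x := by
  choose p hpK hp_min using exists_norm_eq_iInf_of_complete_convex hne hcomplete hconv
  have obtuse : ∀ x, ∀ w ∈ K, inner ℝ (x - p x) (w - p x) ≤ 0 := fun x =>
    (norm_eq_iInf_iff_real_inner_le_zero hconv (hpK x)).1 (hp_min x)
  refine ⟨fun x => ⟨p x, hpK x⟩, LipschitzWith.of_dist_le_mul fun x y => ?_, fun x => ?_⟩
  · rw [NNReal.coe_one, one_mul, Subtype.dist_eq, dist_eq_norm, dist_eq_norm]
    have norm_sq_le : ‖p x - p y‖ * ‖p x - p y‖ ≤ ‖x - y‖ * ‖p x - p y‖ :=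
      calc ‖p x - p y‖ * ‖p x - p y‖
          = inner ℝ (x - y) (p x - p y) + inner ℝ (x - p x) (p y - p x)
            + inner ℝ (y - p y) (p x - p y) := by
            rw [← real_inner_self_eq_norm_mul_norm, ← neg_sub (p x) (p y), inner_neg_right]
            simp only [inner_sub_left]
            ring
        _ ≤ inner ℝ (x - y) (p x - p y) := by
            linarith [obtuse x (p y) (hpK y), obtuse y (p x) (hpK x)]
        _ ≤ ‖x - y‖ * ‖p x - p y‖ := real_inner_le_norm _ _
    nlinarith [norm_nonneg (x - y), norm_nonneg (p x - p y)]
  · have : inner ℝ ((x : E) - p x) (x - p x) ≤ 0 := obtuse x x x.2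
    exact Subtype.ext (sub_eq_zero.1 (real_inner_self_nonpos.1 this)).symm

variable [FiniteDimensional ℝ E]

theorem det_eq_zero_of_eventually_norm_eq {f : E → E} {f' : E →L[ℝ] E} {x : E}
    (hf : HasFDerivAt f f' x) (hx : f x ≠ 0) (hnorm : ∀ᶠ y in 𝓝 x, ‖f y‖ = ‖f x‖) :
    f'.det = 0 := by
  have deriv_zero : HasFDerivAt (fun y => ‖f y‖ ^ 2) (0 : E →L[ℝ] ℝ) x :=
    (hasFDerivAt_const (‖f x‖ ^ 2) x).congr_of_eventuallyEq
      (hnorm.mono fun y hy => by simp only [hy])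
  have orthogonal : ∀ z, inner ℝ (f x) (f' z) = 0 := fun z => by
    have := DFunLike.congr_fun (hf.norm_sq.unique deriv_zero) z
    simpa using this
  by_contra hdet
  obtain ⟨z, hz⟩ := (LinearMap.equivOfDetNeZero (f' : E →ₗ[ℝ] E) hdet).surjective (f x)
  have hz : f' z = f x := hz
  exact hx (inner_self_eq_zero.1 (hz ▸ orthogonal z))

theorem exists_norm_ne_of_contDiff_of_eqOn_sphere {r : E → E} {R : ℝ} (hR : 0 < R)
    (hr : ContDiff ℝ 1 r) (hsphere : ∀ x ∈ sphere 0 R, r x = x) : ∃ x ∈ ball 0 R, ‖r x‖ ≠ R := by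
  by_contra! hnorm
  borelize E
  let h : E → E := (ball 0 R).indicator fun x => r x - x
  have hsub : ContDiff ℝ 1 fun x => r x - x := hr.sub contDiff_id
  obtain ⟨L, hL⟩ := exists_lipschitzWith_indicator_ball_of_contDiff hsub fun x hx =>
    sub_eq_zero.2 (hsphere x hx)
  have hh : ∀ x ∈ ball (0 : E) R, h =ᶠ[𝓝 x] fun x => r x - x := fun x hx =>
    (Set.eqOn_indicator).eventuallyEq_of_mem (isOpen_ball.mem_nhds hx)
  have hd : ∀ x ∈ ball (0 : E) R, DifferentiableAt ℝ h x := fun x hx =>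
    (hsub.differentiable one_ne_zero x).congr_of_eventuallyEq (hh x hx)
  have det_zero : ∀ x ∈ ball (0 : E) R, (1 + (1 : ℝ) • fderiv ℝ h x).det = 0 := by
    intro x hx
    have : 1 + (1 : ℝ) • fderiv ℝ h x = fderiv ℝ r x := by
      have hfderiv : HasFDerivAt (fun x => r x - x) (fderiv ℝ r x - 1) x :=
        (hr.differentiable one_ne_zero x).hasFDerivAt.sub (hasFDerivAt_id x)
      rw [one_smul, (hh x hx).fderiv_eq, hfderiv.fderiv, add_sub_cancel]
    rw [this]
    refine det_eq_zero_of_eventually_norm_eq (hr.differentiable one_ne_zero x).hasFDerivAt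
      (norm_ne_zero_iff.1 ((hnorm x hx).trans_ne hR.ne')) ?_
    filter_upwards [isOpen_ball.mem_nhds hx] with y hy
    rw [hnorm x hx, hnorm y hy]
  have volume_eq_zero : volume.real (ball (0 : E) R) = 0 := by
    rw [← setIntegral_det_one_add_smul_fderiv volume measurableSet_ball measure_ball_lt_top hL hd
      (fun x hx => Set.indicator_of_notMem hx _) 1,
      setIntegral_congr_fun measurableSet_ball det_zero]
    simp
  exact (ENNReal.toReal_pos (measure_ball_pos _ _ hR).ne' measure_ball_lt_top.ne).ne'
    volume_eq_zero

theorem exists_fixedPoint_of_contDiff_of_hasCompactSupport {v : E → E} (hv : ContDiff ℝ 1 v)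
    (hsupp : HasCompactSupport v) : ∃ x, v x = x := by
  by_contra! hfix
  have sub_ne : ∀ x, x - v x ≠ 0 := fun x => sub_ne_zero.2 (hfix x).symm
  obtain ⟨R, hR, hvR⟩ := hsupp.isCompact.isBounded.subset_ball_lt 0 0
  have hw : ContDiff ℝ 1 fun x => x - v x := contDiff_id.sub hv
  obtain ⟨x, -, hx⟩ := exists_norm_ne_of_contDiff_of_eqOn_sphere
    (r := fun x => (R / ‖x - v x‖) • (x - v x)) hR
    ((contDiff_const.div (hw.norm ℝ sub_ne) fun x => norm_ne_zero_iff.2 (sub_ne x)).smul hw)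
    (fun x hx => by
      have hvx : v x = 0 := image_eq_zero_of_notMem_tsupport fun h =>
        (mem_ball_zero_iff.1 (hvR h)).ne (mem_sphere_zero_iff_norm.1 hx)
      rw [hvx, sub_zero, mem_sphere_zero_iff_norm.1 hx, div_self hR.ne', one_smul])
  refine hx ?_
  rw [norm_smul, norm_div, norm_norm, Real.norm_of_nonneg hR.le,
    div_mul_cancel₀ _ (norm_ne_zero_iff.2 (sub_ne x))]

theorem exists_fixedPoint_of_continuous_of_hasCompactSupport {u : E → E} (hu : Continuous u)
    (hsupp : HasCompactSupport u) : ∃ x, u x = x := by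
  by_contra! hfix
  obtain ⟨v, hv, hvu, hv_supp⟩ := hu.exists_contDiff_approx 1 (ε := fun x => dist x (u x))
    (by fun_prop) fun x => dist_pos.2 (hfix x).symm
  obtain ⟨x, hx⟩ := exists_fixedPoint_of_contDiff_of_hasCompactSupport hv (hsupp.mono hv_supp)
  exact (hvu x).ne (by rw [hx])

theorem exists_fixedPoint_of_continuous_of_norm_le {g : E → E} (hg : Continuous g) {M : ℝ}
    (hM : ∀ x, ‖g x‖ ≤ M) : ∃ x, g x = x := by
  have hM0 : 0 ≤ M := (norm_nonneg _).trans (hM 0)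
  let χ : ContDiffBump (0 : E) := ⟨M + 1, M + 2, by positivity, by linarith⟩
  obtain ⟨x, hx⟩ := exists_fixedPoint_of_continuous_of_hasCompactSupport
    (χ.continuous.smul hg) χ.hasCompactSupport.smul_right
  have hx : χ x • g x = x := hx
  have norm_le : ‖x‖ ≤ M :=
    calc ‖x‖ = χ x * ‖g x‖ := by rw [← Real.norm_of_nonneg χ.nonneg, ← norm_smul, hx]
      _ ≤ 1 * M := mul_le_mul χ.le_one (hM x) (norm_nonneg _) zero_le_one
      _ = M := one_mul M
  have hχ : χ x = 1 := χ.one_of_mem_closedBall (mem_closedBall_zero_iff.2 (by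
    change ‖x‖ ≤ M + 1
    linarith))
  exact ⟨x, by rwa [hχ, one_smul] at hx⟩

theorem brouwer_fixed_point {V : Type*} [NormedAddCommGroup V] [NormedSpace ℝ V]
    [FiniteDimensional ℝ V] {K : Set V} (hne : K.Nonempty) (hK : IsCompact K) (hconv : Convex ℝ K)
    {f : K → K} (hf : Continuous f) : ∃ x, f x = x := by
  let e : V ≃L[ℝ] EuclideanSpace ℝ (Fin (Module.finrank ℝ V)) := toEuclidean
  obtain ⟨p, hp, hpK⟩ := exists_lipschitzWith_one_retraction (hne.image e)
    (hK.image e.continuous).isComplete (hconv.is_linear_image e.toLinearEquiv.isLinear)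
  let φ : K ≃ₜ e '' K := e.toHomeomorph.image K
  have hg : Continuous fun z => (φ (f (φ.symm (p z)))).val := by
    have := hp.continuous
    fun_prop
  obtain ⟨M, hM⟩ := isBounded_iff_forall_norm_le.1 (hK.image e.continuous).isBounded
  obtain ⟨z, hz⟩ := exists_fixedPoint_of_continuous_of_norm_le hg fun z => hM _ (Subtype.coe_prop _)
  refine ⟨φ.symm (p z), ?_⟩
  have hpz : p z = φ (f (φ.symm (p z))) := by
    conv_lhs => rw [← hz]
    exact hpK _
  exact (φ.symm_apply_eq.2 hpz).symm

end Brouwer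

section Schauder

variable {V : Type*} [NormedAddCommGroup V] [NormedSpace ℝ V] {C : Set V}

theorem exists_continuous_stdSimplex_dist_lt (hC : IsCompact C) {ε : ℝ} (hε : 0 < ε) :
    ∃ (t : Finset V) (Λ : C → stdSimplex ℝ t), ↑t ⊆ C ∧ Continuous Λ ∧
      ∀ y : C, dist (∑ i, Λ y i • (i : V)) y < ε := by
  have : CompactSpace C := isCompact_iff_compactSpace.1 hC
  obtain ⟨t, htC, htfin, hcover⟩ := hC.finite_cover_balls hε
  lift t to Finset V using htfin
  obtain ⟨ρ, hρ⟩ := PartitionOfUnity.exists_isSubordinate isClosed_univ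
    (fun i : t => ((↑) : C → V) ⁻¹' ball i ε) (fun i => isOpen_ball.preimage continuous_subtype_val)
    (fun y _ => by simpa using hcover y.2)
  refine ⟨t, fun y => ⟨fun i => ρ i y, fun i => ρ.nonneg i y, ?_⟩, htC, ?_, fun y => ?_⟩
  · rw [← finsum_eq_sum_of_fintype, ρ.sum_eq_one (Set.mem_univ y)]
  · exact Continuous.subtype_mk (continuous_pi fun i => (ρ i).continuous) _
  · change ∑ i, ρ i y • (i : V) ∈ ball (y : V) ε
    rw [← finsum_eq_sum_of_fintype]
    refine ρ.finsum_smul_mem_convex (g := fun i _ => (i : V)) (Set.mem_univ y) (fun i hi => ?_)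
      (convex_ball _ _)
    exact mem_ball_comm.1 (hρ i (subset_tsupport _ hi))

theorem exists_dist_lt_of_isCompact_of_convex (hne : C.Nonempty) (hC : IsCompact C)
    (hconv : Convex ℝ C) {f : C → C} (hf : Continuous f) {ε : ℝ} (hε : 0 < ε) :
    ∃ x, dist x (f x) < ε := by
  obtain ⟨t, Λ, htC, hΛ, dist_lt⟩ := exists_continuous_stdSimplex_dist_lt hC hε
  let Φ : stdSimplex ℝ t → C := fun w => ⟨∑ i, w i • (i : V),
    hconv.sum_mem (fun i _ => w.2.1 i) w.2.2 fun i _ => htC i.2⟩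
  have hΦ : Continuous Φ := by
    refine Continuous.subtype_mk (continuous_finsetSum _ fun i _ => ?_) _
    exact ((continuous_apply i).comp continuous_subtype_val).smul continuous_const
  obtain ⟨w, hw⟩ := brouwer_fixed_point (hne.elim fun y hy => ⟨_, (Λ ⟨y, hy⟩).2⟩)
    (isCompact_stdSimplex ℝ t) (convex_stdSimplex ℝ t) (hΛ.comp (hf.comp hΦ))
  refine ⟨Φ w, ?_⟩
  calc dist (Φ w) (f (Φ w)) = dist (Φ (Λ (f (Φ w)))) (f (Φ w)) := by
        congr 2
        exact hw.symm
    _ < ε := dist_lt (f (Φ w))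

theorem schauder_fixed_point (hne : C.Nonempty) (hC : IsCompact C) (hconv : Convex ℝ C)
    {f : C → C} (hf : Continuous f) : ∃ x, f x = x := by
  have : CompactSpace C := isCompact_iff_compactSpace.1 hC
  have : Nonempty C := hne.to_subtype
  obtain ⟨x, -, hx⟩ := isCompact_univ.exists_isMinOn Set.univ_nonempty
    (continuous_id.dist hf).continuousOn
  refine ⟨x, by_contra fun hfx => ?_⟩
  obtain ⟨z, hz⟩ := exists_dist_lt_of_isCompact_of_convex hne hC hconv hf
    (dist_pos.2 (Ne.symm hfx))
  exact hz.not_ge (hx (Set.mem_univ z))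

end Schauder

section WeakTopology

variable {𝕜 : Type*} [RCLike 𝕜] {X : Type*} [NormedAddCommGroup X] [NormedSpace 𝕜 X] {K : Set X}

theorem isBounded_of_isCompact_toWeakSpace_image (hK : IsCompact (toWeakSpace 𝕜 X '' K)) :
    Bornology.IsBounded K := by
  obtain ⟨C, hC⟩ := banach_steinhaus
    (g := fun x : K => NormedSpace.inclusionInDoubleDual 𝕜 X x) fun f => by
      have continuous_f : Continuous fun x : WeakSpace 𝕜 X => f ((toWeakSpace 𝕜 X).symm x) :=
        WeakBilin.eval_continuous (topDualPairing 𝕜 X).flip f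
      have hf : IsCompact (f '' K) := by
        have := hK.image continuous_f
        rwa [Set.image_image] at this
      obtain ⟨C, hC⟩ := isBounded_iff_forall_norm_le.1 hf.isBounded
      exact ⟨C, fun x => hC _ ⟨x, x.2, rfl⟩⟩
  refine isBounded_iff_forall_norm_le.2 ⟨C, fun x hx => ?_⟩
  exact ((NormedSpace.inclusionInDoubleDualLi 𝕜).norm_map x).symm.trans_le (hC ⟨x, hx⟩)

theorem IsReflexiveSpace.isCompact_toWeakSpace_image [NormedSpace ℝ X] [IsScalarTower ℝ 𝕜 X]
    (hX : IsReflexiveSpace 𝕜 X) (hconv : Convex ℝ K) (hbdd : Bornology.IsBounded K)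
    (hclosed : IsClosed K) : IsCompact (toWeakSpace 𝕜 X '' K) := by
  rw [← hclosed.closure_eq, hconv.toWeakSpace_closure 𝕜]
  refine NormedSpace.isCompact_closure_of_isBounded 𝕜 X _ ?_ fun φ _ => ?_
  · rwa [Set.preimage_image_eq _ (toWeakSpace 𝕜 X).injective]
  · obtain ⟨x, hx⟩ := hX (WeakDual.toStrongDual φ)
    exact ⟨toWeakSpace 𝕜 X x, congrArg StrongDual.toWeakDual hx⟩

variable {Y : Type*} [NormedAddCommGroup Y] [NormedSpace 𝕜 Y] {T : X →L[𝕜] Y}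

theorem isCompact_image_of_isCompact_toWeakSpace_image (hT : IsCompactOperator T)
    (hK : IsCompact (toWeakSpace 𝕜 X '' K)) : IsCompact (T '' K) := by
  have weakly_compact : IsCompact (toWeakSpace 𝕜 Y '' (T '' K)) := by
    have := hK.image (WeakSpace.map T).continuous
    rw [Set.image_image] at this ⊢
    exact this
  have closed : IsClosed (T '' K) := by
    have := weakly_compact.isClosed.preimage (toWeakSpaceCLM 𝕜 Y).continuous
    rwa [show ⇑(toWeakSpaceCLM 𝕜 Y) = toWeakSpace 𝕜 Y from rfl,
      Set.preimage_image_eq _ (toWeakSpace 𝕜 Y).injective] at this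
  rw [← closed.closure_eq]
  exact hT.isCompact_closure_image_of_bounded (f := (T : X →ₗ[𝕜] Y))
    (isBounded_of_isCompact_toWeakSpace_image hK)

theorem WeaklyConverges.of_tendsto_map (hT : Function.Injective T)
    (hK : IsCompact (toWeakSpace 𝕜 X '' K)) {u : ℕ → X} (hu : ∀ n, u n ∈ K) {x : X} (hx : x ∈ K)
    (h : Tendsto (fun n => T (u n)) atTop (𝓝 (T x))) : WeaklyConverges 𝕜 u x := by
  have : CompactSpace (toWeakSpace 𝕜 X '' K) := isCompact_iff_compactSpace.1 hK
  let g : toWeakSpace 𝕜 X '' K → WeakSpace 𝕜 Y := fun z => WeakSpace.map T z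
  have embedding : IsClosedEmbedding g :=
    ((WeakSpace.map T).continuous.comp continuous_subtype_val).isClosedEmbedding
      fun a b hab => Subtype.ext (hT hab)
  have subtype_tendsto : Tendsto
      (fun n => (⟨toWeakSpace 𝕜 X (u n), u n, hu n, rfl⟩ : toWeakSpace 𝕜 X '' K))
      atTop (𝓝 ⟨toWeakSpace 𝕜 X x, x, hx, rfl⟩) := by
    rw [embedding.isInducing.tendsto_nhds_iff]
    exact ((toWeakSpaceCLM 𝕜 Y).continuous.tendsto (T x)).comp h
  exact (continuous_subtype_val.tendsto _).comp subtype_tendsto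

end WeakTopology

theorem theorem3p2_general
    {𝕜 : Type*} [RCLike 𝕜]
    {X : Type*} [NormedAddCommGroup X] [NormedSpace 𝕜 X] [NormedSpace ℝ X] [IsScalarTower ℝ 𝕜 X]
    {K : Set X} (hK_nonempty : K.Nonempty) (hK_convex : Convex ℝ K)
    (hK_compact : IsCompact (toWeakSpace 𝕜 X '' K))
    {F : K → X} (hF : Set.range F ⊆ K)
    {Y : Type*} [NormedAddCommGroup Y] [NormedSpace 𝕜 Y]
    {ι : X →L[𝕜] Y} (hι_injective : Function.Injective ι) (hι_compact : IsCompactOperator ι)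
    (hF_weak : ∀ (v : ℕ → K) (w : K), WeaklyConverges 𝕜 (fun n => (v n : X)) (w : X) →
      ∃ φ : ℕ → ℕ, StrictMono φ ∧
        Tendsto (fun m => ι (F (v (φ m)))) atTop (𝓝 (ι (F w)))) :
    ∃ x : K, F x = (x : X) := by
  let _ : NormedSpace ℝ Y := NormedSpace.restrictScalars ℝ 𝕜 Y
  have : IsScalarTower ℝ 𝕜 Y := RestrictScalars.isScalarTower ℝ 𝕜 Y
  let F' : K → K := Set.codRestrict F K fun x => hF ⟨x, rfl⟩
  let e : K ≃ ι '' K := Equiv.Set.image ι K hι_injective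
  have he_symm : ∀ c, ι (e.symm c) = c := fun c => congrArg Subtype.val (e.apply_symm_apply c)
  have continuous_conj : Continuous (e.conj F') := by
    refine continuous_iff_seqContinuous.2 fun u c hu => tendsto_of_subseq_tendsto fun ns hns => ?_
    have image_tendsto : Tendsto (fun n => ι (e.symm (u (ns n)))) atTop (𝓝 (ι (e.symm c))) := by
      simp only [he_symm]
      exact (continuous_subtype_val.tendsto c).comp (hu.comp hns)
    obtain ⟨φ, -, hφ⟩ := hF_weak (fun n => e.symm (u (ns n))) (e.symm c) <|
      .of_tendsto_map hι_injective hK_compact (fun n => (e.symm (u (ns n))).2) (e.symm c).2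
        image_tendsto
    exact ⟨φ, tendsto_subtype_rng.2 hφ⟩
  obtain ⟨c, hc⟩ := schauder_fixed_point (hK_nonempty.image ι)
    (isCompact_image_of_isCompact_toWeakSpace_image hι_compact hK_compact)
    (hK_convex.is_linear_image (ι.restrictScalars ℝ).toLinearMap.isLinear) continuous_conj
  exact ⟨e.symm c, congrArg Subtype.val (e.injective (hc.trans (e.apply_symm_apply c).symm))⟩

theorem theorem3p2
    {𝕜 : Type*} [RCLike 𝕜]
    {X : Type*} [NormedAddCommGroup X] [NormedSpace 𝕜 X] [NormedSpace ℝ X]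
    [IsScalarTower ℝ 𝕜 X] [CompleteSpace X]
    (hX : IsReflexiveSpace 𝕜 X)
    (K : Set X) (hK_nonempty : K.Nonempty) (hK_convex : Convex ℝ K)
    (hK_bounded : Bornology.IsBounded K) (hK_closed : IsClosed K)
    (F : K → X) (hF : Set.range F ⊆ K)
    {Y : Type*} [NormedAddCommGroup Y] [NormedSpace 𝕜 Y] [CompleteSpace Y]
    (ι : X →L[𝕜] Y) (hι_injective : Function.Injective ι) (hι_compact : IsCompactOperator ι)
    (hF_weak : ∀ (v : ℕ → K) (w : K), WeaklyConverges 𝕜 (fun n => (v n : X)) (w : X) →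
      ∃ φ : ℕ → ℕ, StrictMono φ ∧
        Tendsto (fun m => ι (F (v (φ m)))) atTop (𝓝 (ι (F w)))) :
    ∃ x : K, F x = (x : X) :=
  theorem3p2_general hK_nonempty hK_convex
    (hX.isCompact_toWeakSpace_image hK_convex hK_bounded hK_closed) hF hι_injective hι_compact
    hF_weak
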